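/- Let $(R,\mathfrak m,k)$ be a commutative noetherian local ring whose Hilbert series $H_R(z)=\sum_{n\ge 0}\operatorname{rank}_k(\mathfrak m^n/\mathfrak m^{n+1})z^n$ equals $1+ez+sz^2$ for some non-negative integers $e$ and $s$. For finitely generated $R$-modules $M$ and $N$, say that $\operatorname{Tor}^R(M,N)$ is bounded if $\operatorname{Tor}_i^R(M,N)=0$ for all $i\gg 0$. (1) If $s=0$, or if $e^2-4s$ is not the square of an integer, then $R$ is Tor-friendly: whenever $M$ and $N$ are finitely generated $R$-modules with $\operatorname{Tor}^R(M,N)$ bounded, $M$ or $N$ has finite projective dimension. (2) If $s=0$, or if $e^2-4s\ne 0$, then $R$ is Tor-persistent: every finitely generated $R$-module $M$ with $\operatorname{Tor}^R(M,M)$ bounded has finite projective dimension. (3) If there are finitely generated $R$-modules $M$ and $N$, both of infinite projective dimension, with $\operatorname{Tor}^R(M,N)$ bounded, then there are positive integers $u$ and $v$ with $H_R(z)=(1+uz)(1+vz)$. -/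

import Mathlib

universe u

open CategoryTheory IsLocalRing

noncomputable section

/-- The `n`-th graded piece `𝔪ⁿM / 𝔪ⁿ⁺¹M` of a module `M` over a local ring, written as
`N / 𝔪N` with `N = 𝔪ⁿM`, so that it carries the structure of an `R/𝔪`-vector space. -/
abbrev gradedPiece (R : Type u) [CommRing R] [IsLocalRing R]
    (M : Type u) [AddCommGroup M] [Module R M] (n : ℕ) : Type u :=
  ↥((maximalIdeal R) ^ n • (⊤ : Submodule R M)) ⧸
    (maximalIdeal R • (⊤ : Submodule R ↥((maximalIdeal R) ^ n • (⊤ : Submodule R M))))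

/-- The Hilbert series `H_M(z) = ∑ rank_k (𝔪ⁿM / 𝔪ⁿ⁺¹M) zⁿ`, where `k = R/𝔪`
(meaningful for `R` noetherian and `M` finitely generated, when all the ranks are finite). -/
def hilbertSeries (R : Type u) [CommRing R] [IsLocalRing R]
    (M : Type u) [AddCommGroup M] [Module R M] : PowerSeries ℕ :=
  PowerSeries.mk fun n => Module.finrank (R ⧸ maximalIdeal R) (gradedPiece R M n)

/-- `Tor^R(M, N)` is bounded: `Tor_i^R(M, N) = 0` for all `i ≫ 0`. -/
def TorBounded {R : Type u} [CommRing R] (M N : ModuleCat.{u} R) : Prop :=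
  ∃ b : ℕ, ∀ i : ℕ, b < i → Limits.IsZero (((Tor (ModuleCat.{u} R) i).obj M).obj N)

/-- `M` has finite projective dimension. -/
def FiniteProjDim {R : Type u} [CommRing R] (M : ModuleCat.{u} R) : Prop :=
  projectiveDimension M ≠ ⊤

/-- `R` is Tor-friendly: for finite modules `M`, `N`, if `Tor^R(M, N)` is bounded then
`M` or `N` has finite projective dimension. -/
def TorFriendly (R : Type u) [CommRing R] : Prop :=
  ∀ M N : ModuleCat.{u} R, Module.Finite R M → Module.Finite R N →
    TorBounded M N → FiniteProjDim M ∨ FiniteProjDim N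

/-- `R` is Tor-persistent: a finite module `M` with `Tor^R(M, M)` bounded has finite
projective dimension. -/
def TorPersistent (R : Type u) [CommRing R] : Prop :=
  ∀ M : ModuleCat.{u} R, Module.Finite R M → TorBounded M M → FiniteProjDim M

end

/-! Let `M` and `N` have infinite projective dimension and bounded Tor, with syzygies `A i`, `B i`
and Betti numbers `a i`, `b i` in minimal free resolutions. By dimension shifting in both variables,
Tor₁ of `A p` and `B q` vanishes for all large `p`, `q`. The Hilbert series forces 𝔪³ = 0, so 𝔪²
kills every later syzygy. Vanishing of Tor₁ then makes tensor products of far syzygies vector spaces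
over k, whose lengths are products of Betti numbers (`length_count`). It also prevents k from
splitting off a far syzygy, which gives 𝔪B = 𝔪²F when F is the free module in which the syzygy B
sits (`smul_eq_sq_smul`). Comparing lengths, the ratios x, y of consecutive Betti numbers satisfy x
+ y = e and xy = s (`IsMinimalResolution.relations`). They are rational roots of a monic integer
polynomial, hence positive integers u, v (`exists_add_mul_of_relations`). Thus s > 0, the Hilbert
series factors, and e² - 4s = (u - v)²; for M = N the two ratios agree and this is zero. -/

open TensorProduct

/-! ### Tor₁ by flat presentations: balancing and dimension shifting. -/

section TorOne

variable {R : Type u} [CommRing R]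

/-- `0 → K → P → Y → 0` is a short exact sequence with `P` flat. -/
structure IsFlatPresentation {K P Y : Type u} [AddCommGroup K] [Module R K]
    [AddCommGroup P] [Module R P] [AddCommGroup Y] [Module R Y]
    (f : K →ₗ[R] P) (g : P →ₗ[R] Y) : Prop where
  injective : Function.Injective f
  exact : Function.Exact f g
  surjective : Function.Surjective g
  flat : Module.Flat R P

/-- The vanishing of `Tor₁(X, Y)`, expressed through flat presentations of `Y`. -/
def TorOneVanishes (R : Type u) [CommRing R] (X Y : Type u) [AddCommGroup X] [Module R X]
    [AddCommGroup Y] [Module R Y] : Prop :=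
  ∀ ⦃K P : Type u⦄ [AddCommGroup K] [Module R K] [AddCommGroup P] [Module R P]
    (f : K →ₗ[R] P) (g : P →ₗ[R] Y), IsFlatPresentation f g → Function.Injective (f.lTensor X)

variable {K P Y L G X : Type u} [AddCommGroup K] [Module R K]
    [AddCommGroup P] [Module R P] [AddCommGroup Y] [Module R Y] [AddCommGroup L] [Module R L]
    [AddCommGroup G] [Module R G] [AddCommGroup X] [Module R X]
    {f : K →ₗ[R] P} {g : P →ₗ[R] Y} {f' : L →ₗ[R] G} {g' : G →ₗ[R] X}

theorem IsFlatPresentation.of_surjective (h : Function.Surjective g) [Module.Flat R P] :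
    IsFlatPresentation (LinearMap.ker g).subtype g :=
  ⟨Subtype.val_injective, LinearMap.exact_subtype_ker_map g, h, inferInstance⟩

theorem exists_isFlatPresentation (Y : Type u) [AddCommGroup Y] [Module R Y] :
    ∃ (K P : Type u) (_ : AddCommGroup K) (_ : Module R K) (_ : AddCommGroup P) (_ : Module R P)
      (f : K →ₗ[R] P) (g : P →ₗ[R] Y), IsFlatPresentation f g :=
  ⟨_, Y →₀ R, _, _, _, _, _, Finsupp.linearCombination R id,
    .of_surjective (Finsupp.linearCombination_id_surjective R Y)⟩

/-- Balancing of Tor₁: a diagram chase in the grid of tensor products of `L → G → X` with `K → P →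
Y`, using flatness of `P`. -/
theorem IsFlatPresentation.rTensor_injective (h : IsFlatPresentation f g)
    (h' : IsFlatPresentation f' g') (H : Function.Injective (f.lTensor X)) :
    Function.Injective (f'.rTensor Y) := by
  have := h.flat
  have comm : ∀ {A B C D : Type u} [AddCommGroup A] [Module R A] [AddCommGroup B] [Module R B]
      [AddCommGroup C] [Module R C] [AddCommGroup D] [Module R D] (a : A →ₗ[R] B) (c : C →ₗ[R] D)
      (z : A ⊗[R] C), a.rTensor D (c.lTensor A z) = c.lTensor B (a.rTensor C z) := by
    intro A B C D _ _ _ _ _ _ _ _ a c z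
    rw [← LinearMap.comp_apply, ← LinearMap.comp_apply, LinearMap.rTensor_comp_lTensor,
      LinearMap.lTensor_comp_rTensor]
  rw [injective_iff_map_eq_zero]
  intro z hz
  obtain ⟨w, rfl⟩ := LinearMap.lTensor_surjective L h.surjective z
  rw [comm] at hz
  obtain ⟨v, hv⟩ := (lTensor_exact G h.exact h.surjective _).1 hz
  have h1 : g'.rTensor K v = 0 := by
    apply H
    rw [← comm, hv, map_zero]
    exact (rTensor_exact P h'.exact h'.surjective _).2 ⟨w, rfl⟩
  obtain ⟨t, rfl⟩ := (rTensor_exact K h'.exact h'.surjective _).1 h1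
  rw [← comm] at hv
  have := Module.Flat.rTensor_preserves_injective_linearMap (M := P) f' h'.injective hv
  exact (lTensor_exact L h.exact h.surjective _).2 ⟨t, this⟩

theorem IsFlatPresentation.lTensor_injective_iff (h : IsFlatPresentation f g)
    (h' : IsFlatPresentation f' g') :
    Function.Injective (f.lTensor X) ↔ Function.Injective (f'.rTensor Y) := by
  refine ⟨h.rTensor_injective h', fun H => ?_⟩
  rw [LinearMap.lTensor_inj_iff_rTensor_inj]
  exact h'.rTensor_injective h ((f'.lTensor_inj_iff_rTensor_inj Y).2 H)

theorem IsFlatPresentation.torOneVanishes_iff_rTensor (h' : IsFlatPresentation f' g')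
    (Y : Type u) [AddCommGroup Y] [Module R Y] :
    TorOneVanishes R X Y ↔ Function.Injective (f'.rTensor Y) := by
  refine ⟨fun H => ?_, fun H K P _ _ _ _ f g h => (h.lTensor_injective_iff h').2 H⟩
  obtain ⟨K, P, _, _, _, _, f, g, h⟩ := exists_isFlatPresentation (R := R) Y
  exact (h.lTensor_injective_iff h').1 (H f g h)

theorem IsFlatPresentation.torOneVanishes_iff_lTensor (h : IsFlatPresentation f g)
    (X : Type u) [AddCommGroup X] [Module R X] :
    TorOneVanishes R X Y ↔ Function.Injective (f.lTensor X) := by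
  obtain ⟨L, G, _, _, _, _, f', g', h'⟩ := exists_isFlatPresentation (R := R) X
  rw [h'.torOneVanishes_iff_rTensor, h.lTensor_injective_iff h']

/-- Dimension shift. -/
theorem IsFlatPresentation.torOneVanishes_shift (h : IsFlatPresentation f g)
    (h' : IsFlatPresentation f' g') : TorOneVanishes R X K ↔ TorOneVanishes R L Y := by
  have := h.flat
  have := h'.flat
  rw [h'.torOneVanishes_iff_rTensor, h.torOneVanishes_iff_lTensor]
  have h1 := Module.Flat.lTensor_preserves_injective_linearMap (M := G) f h.injective
  have h2 := Module.Flat.rTensor_preserves_injective_linearMap (M := P) f' h'.injective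
  -- Both maps start at `L ⊗ K`, and they coincide once followed by the injections into `G ⊗ P`.
  rw [← Function.Injective.of_comp_iff h1, ← Function.Injective.of_comp_iff h2,
    ← LinearMap.coe_comp, ← LinearMap.coe_comp, LinearMap.rTensor_comp_lTensor,
    LinearMap.lTensor_comp_rTensor]

/-- `K` is a first syzygy of `Y` with respect to some flat cover. -/
def IsSyzygy (K Y : ModuleCat.{u} R) : Prop :=
  ∃ (P : ModuleCat.{u} R) (f : K →ₗ[R] P) (g : P →ₗ[R] Y), IsFlatPresentation f g

theorem torOneVanishes_add_iff {A B : ℕ → ModuleCat.{u} R} (hA : ∀ i, IsSyzygy (A (i + 1)) (A i))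
    (hB : ∀ i, IsSyzygy (B (i + 1)) (B i)) (i j : ℕ) :
    TorOneVanishes R (A (i + j)) (B 0) ↔ TorOneVanishes R (A i) (B j) := by
  induction j generalizing i with
  | zero => rfl
  | succ j ih =>
    obtain ⟨P, f, g, h⟩ := hB j
    obtain ⟨P', f', g', h'⟩ := hA i
    rw [h.torOneVanishes_shift h', ← ih, Nat.add_right_comm, Nat.add_assoc]

end TorOne

/-! ### From the derived functor Tor to Tor₁ of syzygies. -/

section Bridge

variable {R : Type u} [CommRing R]

theorem function_exact_lTensor_of_isZero_Tor {M N : ModuleCat.{u} R} (P : ProjectiveResolution N)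
    (i : ℕ) (h : Limits.IsZero (((Tor (ModuleCat.{u} R) (i + 1)).obj M).obj N)) :
    Function.Exact ((P.complex.d (i + 2) (i + 1)).hom.lTensor M)
      ((P.complex.d (i + 1) i).hom.lTensor M) := by
  have h1 := h.of_iso (P.isoLeftDerivedObj
    ((MonoidalCategory.tensoringLeft (ModuleCat.{u} R)).obj M) (i + 1)).symm
  have h2 := (HomologicalComplex.exactAt_iff_isZero_homology _ _).2 h1
  rw [HomologicalComplex.exactAt_iff' _ (i + 2) (i + 1) i (by simp) (by simp)] at h2
  exact (ShortComplex.ShortExact.moduleCat_exact_iff_function_exact _).1 h2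

/-- A tensor killed in `M ⊗ C` lifts to `M ⊗ B`, where exactness brings it from `M ⊗ A`; its class
in `M ⊗ range d` is zero because `d ∘ d' = 0`. -/
theorem lTensor_range_subtype_injective {A B C : Type u} [AddCommGroup A] [Module R A]
    [AddCommGroup B] [Module R B] [AddCommGroup C] [Module R C] {d' : A →ₗ[R] B} {d : B →ₗ[R] C}
    (h : d ∘ₗ d' = 0) (M : Type u) [AddCommGroup M] [Module R M]
    (hM : Function.Exact (d'.lTensor M) (d.lTensor M)) :
    Function.Injective ((LinearMap.range d).subtype.lTensor M) := by
  rw [injective_iff_map_eq_zero]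
  intro z hz
  obtain ⟨w, rfl⟩ := LinearMap.lTensor_surjective M d.surjective_rangeRestrict z
  rw [← LinearMap.comp_apply, ← LinearMap.lTensor_comp] at hz
  obtain ⟨v, rfl⟩ := (hM w).1 hz
  have h0 : d.rangeRestrict ∘ₗ d' = 0 := by
    ext x
    exact LinearMap.congr_fun h x
  rw [← LinearMap.comp_apply, ← LinearMap.lTensor_comp, h0, LinearMap.lTensor_zero,
    LinearMap.zero_apply]

theorem CategoryTheory.ProjectiveResolution.exists_syzygies {N : ModuleCat.{u} R}
    (P : ProjectiveResolution N) :
    ∃ B : ℕ → ModuleCat.{u} R, B 0 = N ∧ (∀ i, IsSyzygy (B (i + 1)) (B i)) ∧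
      ∀ (M : ModuleCat.{u} R) (i : ℕ), 0 < i →
        Limits.IsZero (((Tor (ModuleCat.{u} R) (i + 1)).obj M).obj N) →
        TorOneVanishes R M (B i) := by
  let K (j : ℕ) := LinearMap.range (P.complex.d (j + 1) j).hom
  let B : ℕ → ModuleCat.{u} R
    | 0 => N
    | j + 1 => ModuleCat.of R (K j)
  have hflat (j : ℕ) : Module.Flat R (P.complex.X j) := by
    have : Module.Projective R (P.complex.X j) :=
      (IsProjective.iff_projective _).2 (P.projective j)
    infer_instance
  have hexact (j : ℕ) : Function.Exact (P.complex.d (j + 2) (j + 1)).hom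
      (P.complex.d (j + 1) j).hom :=
    (ShortComplex.ShortExact.moduleCat_exact_iff_function_exact _).1 (P.exact_succ j)
  have hpres (j : ℕ) : IsFlatPresentation (K (j + 1)).subtype
      (P.complex.d (j + 1) j).hom.rangeRestrict := by
    refine ⟨Subtype.val_injective, ?_, LinearMap.surjective_rangeRestrict _, hflat _⟩
    rw [LinearMap.exact_iff, LinearMap.ker_rangeRestrict, Submodule.range_subtype]
    exact (LinearMap.exact_iff.1 (hexact j))
  have hpres₀ : ∃ g : P.complex.X 0 →ₗ[R] N, IsFlatPresentation (K 0).subtype g := by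
    let g : P.complex.X 0 →ₗ[R] N := (P.π.f 0).hom
    have hg : Function.Surjective g := (ModuleCat.epi_iff_surjective (P.π.f 0)).1 inferInstance
    have hg' : Function.Exact (P.complex.d 1 0).hom g :=
      (ShortComplex.ShortExact.moduleCat_exact_iff_function_exact _).1 P.exact₀
    refine ⟨g, Subtype.val_injective, ?_, hg, hflat _⟩
    rw [LinearMap.exact_iff, Submodule.range_subtype]
    exact LinearMap.exact_iff.1 hg'
  refine ⟨B, rfl, ?_, ?_⟩
  · rintro (_ | j)
    · exact ⟨_, _, hpres₀⟩
    · exact ⟨_, _, _, hpres j⟩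
  · rintro M (_ | j) hj h
    · omega
    · refine ((hpres j).torOneVanishes_iff_lTensor M).2 ?_
      exact lTensor_range_subtype_injective (hexact (j + 1)).linearMap_comp_eq_zero _
        (function_exact_lTensor_of_isZero_Tor P (j + 1) h)

theorem TorBounded.exists_torOneVanishes {M N : ModuleCat.{u} R} (h : TorBounded M N) :
    ∃ B : ℕ → ModuleCat.{u} R, B 0 = N ∧ (∀ i, IsSyzygy (B (i + 1)) (B i)) ∧
      ∃ b, ∀ i, b ≤ i → TorOneVanishes R M (B i) := by
  obtain ⟨B, h0, hB, hT⟩ := (projectiveResolution N).exists_syzygies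
  obtain ⟨b, hb⟩ := h
  exact ⟨B, h0, hB, b + 1, fun i hi => hT M i (by omega) (hb _ (by omega))⟩

end Bridge

/-! ### Tensor products, annihilation by an ideal, and lengths. -/

section Annihilation

variable {R : Type u} [CommRing R] {F X Y W : Type u} [AddCommGroup F] [Module R F]
  [AddCommGroup X] [Module R X] [AddCommGroup Y] [Module R Y] [AddCommGroup W] [Module R W]

theorem smul_top_eq_bot_iff {I : Ideal R} :
    I • (⊤ : Submodule R W) = ⊥ ↔ ∀ a ∈ I, ∀ w : W, a • w = 0 := by
  rw [eq_bot_iff, Submodule.smul_le]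
  simp

theorem smul_top_tensor_eq_bot {I : Ideal R} (h : I • (⊤ : Submodule R W) = ⊥)
    (F : Type u) [AddCommGroup F] [Module R F] : I • (⊤ : Submodule R (F ⊗[R] W)) = ⊥ := by
  rw [smul_top_eq_bot_iff] at h ⊢
  intro a ha z
  induction z using TensorProduct.induction_on with
  | zero => simp
  | add x y hx hy => rw [smul_add, hx, hy, add_zero]
  | tmul x w => rw [← TensorProduct.tmul_smul, h a ha, TensorProduct.tmul_zero]

theorem range_rTensor_le {I : Ideal R} {f : X →ₗ[R] F} (h : LinearMap.range f ≤ I • ⊤)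
    (W : Type u) [AddCommGroup W] [Module R W] :
    LinearMap.range (f.rTensor W) ≤ I • ⊤ := by
  rintro _ ⟨z, rfl⟩
  induction z using TensorProduct.induction_on with
  | zero => simp
  | add x y hx hy => rw [map_add]; exact add_mem hx hy
  | tmul x w =>
    rw [LinearMap.rTensor_tmul]
    have hx : f x ∈ I • (⊤ : Submodule R F) := h ⟨x, rfl⟩
    generalize f x = y at hx
    induction hx using Submodule.smul_induction_on' with
    | smul a ha y _ =>
      rw [← TensorProduct.smul_tmul']
      exact Submodule.smul_mem_smul ha trivial
    | add x _ y _ hx hy => rw [TensorProduct.add_tmul]; exact add_mem hx hy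

theorem rTensor_eq_zero {I : Ideal R} {f : X →ₗ[R] F} (h : LinearMap.range f ≤ I • ⊤)
    (hW : I • (⊤ : Submodule R W) = ⊥) : f.rTensor W = 0 := by
  rw [← LinearMap.range_eq_bot, eq_bot_iff, ← smul_top_tensor_eq_bot hW F]
  exact range_rTensor_le h W

theorem smul_top_quotient_eq_bot (I : Ideal R) : I • (⊤ : Submodule R (R ⧸ I)) = ⊥ := by
  rw [smul_top_eq_bot_iff]
  intro a ha w
  rw [Algebra.smul_def, Ideal.Quotient.algebraMap_eq, Ideal.Quotient.eq_zero_iff_mem.2 ha, zero_mul]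

theorem lTensor_bijective_of_ker_le {g : F →ₗ[R] Y}
    (hg : Function.Surjective g) {I : Ideal R} (hker : LinearMap.ker g ≤ I • ⊤) :
    Function.Bijective (g.lTensor (R ⧸ I)) := by
  refine ⟨?_, LinearMap.lTensor_surjective _ hg⟩
  have h0 : (LinearMap.ker g).subtype.rTensor (R ⧸ I) = 0 :=
    rTensor_eq_zero (by rwa [Submodule.range_subtype]) (smul_top_quotient_eq_bot I)
  rw [LinearMap.lTensor_inj_iff_rTensor_inj, injective_iff_map_eq_zero]
  intro z hz
  obtain ⟨w, rfl⟩ := (rTensor_exact (R ⧸ I) (LinearMap.exact_subtype_ker_map g) hg z).1 hz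
  rw [h0, LinearMap.zero_apply]

variable (R) in
theorem length_add_smul_top (I : Ideal R) (Y : Type u) [AddCommGroup Y] [Module R Y] :
    Module.length R Y = Module.length R (I • ⊤ : Submodule R Y) +
      Module.length R (Y ⧸ (I • ⊤ : Submodule R Y)) :=
  Module.length_eq_add_of_exact _ _ (Submodule.subtype_injective _) (Submodule.mkQ_surjective _)
    (LinearMap.exact_subtype_mkQ _)

theorem length_quotient_smul_top (I : Ideal R) (Y : Type u) [AddCommGroup Y] [Module R Y] :
    Module.length R (Y ⧸ (I • ⊤ : Submodule R Y)) = Module.length R ((R ⧸ I) ⊗[R] Y) :=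
  (TensorProduct.quotTensorEquivQuotSMul Y I).symm.length_eq

theorem length_tensor_pi (W : Type u) [AddCommGroup W] [Module R W] (n : ℕ) :
    Module.length R (W ⊗[R] (Fin n → R)) = n * Module.length R W := by
  rw [(TensorProduct.piScalarRight R R W (Fin n)).length_eq]
  simp

theorem length_pi_quotient (I : Ideal R) (n : ℕ) :
    Module.length R ((Fin n → R) ⧸ (I • ⊤ : Submodule R (Fin n → R))) =
      n * Module.length R (R ⧸ I) := by
  rw [length_quotient_smul_top, length_tensor_pi]

end Annihilation

/-! ### Minimal presentations and the consequences of vanishing Tor₁. -/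

section Length

variable {R : Type u} [CommRing R] [IsLocalRing R]

/-- The exact sequence `0 → K → Rⁿ → Y → 0` is the start of a minimal free resolution of `Y`. -/
structure IsMinimalPresentation {K Y : Type u} [AddCommGroup K] [Module R K]
    [AddCommGroup Y] [Module R Y] {n : ℕ} (f : K →ₗ[R] (Fin n → R)) (g : (Fin n → R) →ₗ[R] Y) :
    Prop extends IsFlatPresentation f g where
  range_le : LinearMap.range f ≤ maximalIdeal R • ⊤

theorem exists_minimal_cover (Y : Type u) [AddCommGroup Y] [Module R Y] [Module.Finite R Y] :
    ∃ (n : ℕ) (g : (Fin n → R) →ₗ[R] Y), Function.Surjective g ∧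
      LinearMap.ker g ≤ maximalIdeal R • ⊤ := by
  let := Ideal.Quotient.field (maximalIdeal R)
  let V := Y ⧸ (maximalIdeal R • ⊤ : Submodule R Y)
  have : Module.Finite (R ⧸ maximalIdeal R) V := .of_restrictScalars_finite R _ _
  let b := Module.finBasis (R ⧸ maximalIdeal R) V
  choose v hv using fun i => Submodule.mkQ_surjective _ (b i)
  refine ⟨_, Fintype.linearCombination R v, ?_, ?_⟩
  · rw [← LinearMap.range_eq_top, Fintype.range_linearCombination, ← map_mkQ_eq_top,
      Submodule.map_span, ← Set.range_comp, eq_top_iff]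
    intro z _
    have hz : z ∈ Submodule.span (R ⧸ maximalIdeal R) (Set.range b) := by
      rw [b.span_eq]; trivial
    rw [← Submodule.restrictScalars_mem R, Submodule.restrictScalars_span R _
      Ideal.Quotient.mk_surjective] at hz
    convert! hz using 3
    exact funext hv
  · intro c hc
    have h1 : ∑ i, (Ideal.Quotient.mk (maximalIdeal R) (c i)) • b i = 0 := by
      have := congr_arg (Submodule.mkQ (maximalIdeal R • ⊤ : Submodule R Y)) hc
      rw [Fintype.linearCombination_apply, map_zero, map_sum] at this
      rw [← this]
      refine Finset.sum_congr rfl fun i _ => ?_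
      rw [map_smul, hv]
      rfl
    have h2 := Fintype.linearIndependent_iff.1 b.linearIndependent _ h1
    rw [pi_eq_sum_univ' c]
    exact Submodule.sum_mem _ fun i _ => Submodule.smul_mem_smul
      (Ideal.Quotient.eq_zero_iff_mem.1 (h2 i)) trivial

/-- The minimal number of generators of a finite module, as a length. -/
noncomputable def betti (R : Type u) [CommRing R] [IsLocalRing R]
    (Y : Type u) [AddCommGroup Y] [Module R Y] : ℕ∞ :=
  Module.length R (Y ⧸ (maximalIdeal R • ⊤ : Submodule R Y))

variable {X Y Z W : Type u} [AddCommGroup X] [Module R X]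
    [AddCommGroup Y] [Module R Y] [AddCommGroup Z] [Module R Z] [AddCommGroup W] [Module R W]

theorem IsMinimalPresentation.lTensor_bijective {n : ℕ} {f : X →ₗ[R] (Fin n → R)}
    {g : (Fin n → R) →ₗ[R] Y} (h : IsMinimalPresentation f g) :
    Function.Bijective (g.lTensor (R ⧸ maximalIdeal R)) :=
  lTensor_bijective_of_ker_le h.surjective (h.exact.linearMap_ker_eq ▸ h.range_le)

theorem length_residue : Module.length R (R ⧸ maximalIdeal R) = 1 := by
  rw [Module.length_eq_one_iff]
  exact isSimpleModule_iff_isCoatom.2 (maximalIdeal.isMaximal R).out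

theorem IsMinimalPresentation.betti_eq {n : ℕ} {f : X →ₗ[R] (Fin n → R)}
    {g : (Fin n → R) →ₗ[R] Y} (h : IsMinimalPresentation f g) : betti R Y = n := by
  rw [betti, length_quotient_smul_top,
    ← (LinearEquiv.ofBijective _ h.lTensor_bijective).length_eq, length_tensor_pi, length_residue,
    mul_one]

/-- Minimality gives k ⊗ Rⁿ ≅ k ⊗ Y, so k ⊗ X ⊗ Y is n copies of k ⊗ X. -/
theorem betti_tensor (X Y : Type u) [AddCommGroup X] [Module R X] [AddCommGroup Y] [Module R Y]
    [Module.Finite R Y] :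
    betti R (X ⊗[R] Y) = betti R X * betti R Y := by
  obtain ⟨n, g, hg, hk⟩ := exists_minimal_cover (R := R) Y
  have h : IsMinimalPresentation (LinearMap.ker g).subtype g :=
    ⟨.of_surjective hg, by rwa [Submodule.range_subtype]⟩
  have e : ((R ⧸ maximalIdeal R) ⊗[R] X) ⊗[R] (Fin n → R) ≃ₗ[R]
      (R ⧸ maximalIdeal R) ⊗[R] (X ⊗[R] Y) :=
    (TensorProduct.congr (TensorProduct.comm R _ _) (.refl R _)).trans <|
    (TensorProduct.assoc R _ _ _).trans <|
    (TensorProduct.congr (.refl R X) (LinearEquiv.ofBijective _ h.lTensor_bijective)).trans <|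
    TensorProduct.leftComm R _ _ _
  rw [h.betti_eq, betti, betti, length_quotient_smul_top, length_quotient_smul_top, mul_comm,
    ← length_tensor_pi]
  exact e.symm.length_eq

theorem betti_eq_length (h : maximalIdeal R • (⊤ : Submodule R Y) = ⊥) :
    betti R Y = Module.length R Y := by
  rw [length_add_smul_top R (maximalIdeal R), h, Module.length_bot, zero_add, betti, h]

/-- `X ⊗ W` embeds in 𝔪(Rⁿ ⊗ W), which 𝔪 kills because 𝔪²W = 0. -/
theorem IsMinimalPresentation.smul_tensor_eq_bot {n : ℕ} {f : X →ₗ[R] (Fin n → R)}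
    {g : (Fin n → R) →ₗ[R] Y} (h : IsMinimalPresentation f g)
    (hW : maximalIdeal R ^ 2 • (⊤ : Submodule R W) = ⊥)
    (hT : TorOneVanishes R Y W) : maximalIdeal R • (⊤ : Submodule R (X ⊗[R] W)) = ⊥ := by
  rw [smul_top_eq_bot_iff]
  intro a ha t
  apply (h.torOneVanishes_iff_rTensor W).1 hT
  rw [map_zero, map_smul, ← Submodule.mem_bot R, ← smul_top_tensor_eq_bot hW, pow_two,
    Submodule.mul_smul]
  exact Submodule.smul_mem_smul ha (range_rTensor_le h.range_le W ⟨t, rfl⟩)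

theorem IsMinimalPresentation.sq_smul_top_eq_bot {n : ℕ} {f : X →ₗ[R] (Fin n → R)}
    {g : (Fin n → R) →ₗ[R] Y} (h : IsMinimalPresentation f g) (h3 : maximalIdeal R ^ 3 = ⊥) :
    maximalIdeal R ^ 2 • (⊤ : Submodule R X) = ⊥ := by
  rw [smul_top_eq_bot_iff]
  intro a ha x
  apply h.injective
  have h0 : maximalIdeal R ^ 3 • (⊤ : Submodule R (Fin n → R)) = ⊥ := by rw [h3, Submodule.bot_smul]
  rw [map_zero, map_smul, ← Submodule.mem_bot R, ← h0, pow_succ, Submodule.mul_smul]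
  exact Submodule.smul_mem_smul ha (h.range_le ⟨x, rfl⟩)

/-- Length count on `0 → X₂ ⊗ W → Rⁿ ⊗ W → X₁ ⊗ W → 0`. -/
theorem length_count {X₀ X₁ X₂ : Type u} [AddCommGroup X₀] [Module R X₀]
    [AddCommGroup X₁] [Module R X₁] [AddCommGroup X₂] [Module R X₂] [Module.Finite R W]
    {m n : ℕ} {f : X₁ →ₗ[R] (Fin m → R)}
    {g : (Fin m → R) →ₗ[R] X₀} (h : IsMinimalPresentation f g)
    {f' : X₂ →ₗ[R] (Fin n → R)} {g' : (Fin n → R) →ₗ[R] X₁} (h' : IsMinimalPresentation f' g')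
    (hW : maximalIdeal R ^ 2 • (⊤ : Submodule R W) = ⊥)
    (hT : TorOneVanishes R X₀ W) (hT' : TorOneVanishes R X₁ W) :
    n * Module.length R W = betti R X₂ * betti R W + n * betti R W := by
  rw [← h'.betti_eq, ← betti_tensor, ← betti_tensor,
    betti_eq_length (h.smul_tensor_eq_bot hW hT), betti_eq_length (h'.smul_tensor_eq_bot hW hT'),
    h'.betti_eq, ← length_tensor_pi, (TensorProduct.comm R W _).length_eq]
  exact Module.length_eq_add_of_exact _ _ ((h'.torOneVanishes_iff_rTensor W).1 hT')
    (LinearMap.rTensor_surjective W h'.surjective) (rTensor_exact W h'.exact h'.surjective)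

/-- A minimal generator annihilated by the maximal ideal spans a direct summand `k`. -/
theorem exists_retract_residue {y : Y} (hy : y ∉ maximalIdeal R • (⊤ : Submodule R Y))
    (h0 : ∀ a ∈ maximalIdeal R, a • y = 0) :
    ∃ (i : (R ⧸ maximalIdeal R) →ₗ[R] Y) (p : Y →ₗ[R] (R ⧸ maximalIdeal R)),
      p ∘ₗ i = LinearMap.id := by
  let := Ideal.Quotient.field (maximalIdeal R)
  let V := Y ⧸ (maximalIdeal R • ⊤ : Submodule R Y)
  let v : V := Submodule.Quotient.mk y
  have hv : v ≠ 0 := by rwa [Ne, Submodule.Quotient.mk_eq_zero]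
  obtain ⟨φ, hφ⟩ : ∃ φ : Module.Dual (R ⧸ maximalIdeal R) V, φ v ≠ 0 := by
    by_contra! H
    exact hv ((Module.forall_dual_apply_eq_zero_iff (R ⧸ maximalIdeal R) v).1 H)
  refine ⟨Submodule.liftQ _ (LinearMap.toSpanSingleton R Y y) fun a ha => h0 a ha,
    (((φ v)⁻¹ • φ).restrictScalars R) ∘ₗ Submodule.mkQ _, ?_⟩
  ext
  change (φ v)⁻¹ * φ (Submodule.Quotient.mk ((1 : R) • y)) = 1
  rw [one_smul]
  exact inv_mul_cancel₀ hφ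

/-- If k were a retract of `W`, then X ⊗ k → X ⊗ W → Rⁿ ⊗ W would be injective. It factors through
`f ⊗ k = 0`, so X ⊗ k = 0 and Nakayama gives X = 0. -/
theorem IsMinimalPresentation.not_retract [IsNoetherianRing R] {n : ℕ} {f : X →ₗ[R] (Fin n → R)}
    {g : (Fin n → R) →ₗ[R] Y} (h : IsMinimalPresentation f g) [Nontrivial X]
    (hT : TorOneVanishes R Y W) (i : (R ⧸ maximalIdeal R) →ₗ[R] W)
    (p : W →ₗ[R] (R ⧸ maximalIdeal R)) : p ∘ₗ i ≠ LinearMap.id := by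
  intro hp
  have h1 : Function.Injective (i.lTensor X) := by
    apply Function.LeftInverse.injective (g := p.lTensor X)
    intro z
    rw [← LinearMap.comp_apply, ← LinearMap.lTensor_comp, hp, LinearMap.lTensor_id,
      LinearMap.id_apply]
  have h2 := ((h.torOneVanishes_iff_rTensor W).1 hT).comp h1
  rw [← LinearMap.coe_comp, LinearMap.rTensor_comp_lTensor, ← LinearMap.lTensor_comp_rTensor,
    rTensor_eq_zero h.range_le (smul_top_quotient_eq_bot _), LinearMap.comp_zero] at h2
  have : Subsingleton (X ⊗[R] (R ⧸ maximalIdeal R)) := ⟨fun a b => h2 rfl⟩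
  have h3 : Subsingleton (ResidueField R ⊗[R] X) :=
    (TensorProduct.comm R (R ⧸ maximalIdeal R) X).toEquiv.subsingleton
  have : Module.Finite R X := .of_injective f h.injective
  exact not_subsingleton X ((subsingleton_tensorProduct (R := R)).1 h3)

theorem smul_eq_sq_smul [IsNoetherianRing R] {X₁ X₂ Y₁ Y₂ : Type u}
    [AddCommGroup X₁] [Module R X₁] [AddCommGroup X₂] [Module R X₂]
    [AddCommGroup Y₁] [Module R Y₁] [AddCommGroup Y₂] [Module R Y₂]
    {m n : ℕ} {f : X₂ →ₗ[R] (Fin m → R)} {g : (Fin m → R) →ₗ[R] X₁}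
    (h : IsMinimalPresentation f g) [Nontrivial X₂]
    {f' : Y₂ →ₗ[R] (Fin n → R)} {g' : (Fin n → R) →ₗ[R] Y₁} (h' : IsMinimalPresentation f' g')
    (h3 : maximalIdeal R ^ 3 = ⊥) (hY : maximalIdeal R ^ 2 • (⊤ : Submodule R Y₁) = ⊥)
    (hT : TorOneVanishes R X₁ Y₂) :
    (maximalIdeal R • (⊤ : Submodule R Y₂)).map f' = maximalIdeal R ^ 2 • ⊤ := by
  have h0 : maximalIdeal R ^ 3 • (⊤ : Submodule R (Fin n → R)) = ⊥ := by rw [h3, Submodule.bot_smul]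
  apply le_antisymm
  · rw [Submodule.map_smul'', Submodule.map_top, pow_two, Submodule.mul_smul]
    exact Submodule.smul_mono le_rfl h'.range_le
  · intro z hz
    have hz' : g' z = 0 := by
      rw [← Submodule.mem_bot R, ← hY]
      refine (Submodule.map_smul'' (maximalIdeal R ^ 2) ⊤ g').le.trans
        (Submodule.smul_mono le_rfl le_top) ⟨z, hz, rfl⟩
    obtain ⟨y, rfl⟩ := (h'.exact z).1 hz'
    refine ⟨y, ?_, rfl⟩
    -- Since 𝔪³ = 0, the element `y` is killed by 𝔪; outside 𝔪Y₂ it would split off a copy of k.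
    by_contra hy
    obtain ⟨i, p, hp⟩ := exists_retract_residue hy fun a ha => h'.injective <| by
      rw [map_zero, map_smul, ← Submodule.mem_bot R, ← h0, pow_succ', Submodule.mul_smul]
      exact Submodule.smul_mem_smul ha hz
    exact h.not_retract hT i p hp

end Length

/-! ### Lengths read off the Hilbert series. -/

section HilbertSeries

variable {R : Type u} [CommRing R] [IsLocalRing R] [IsNoetherianRing R]

theorem length_gradedPiece (M : Type u) [AddCommGroup M] [Module R M] [Module.Finite R M] (n : ℕ) :
    Module.length R (gradedPiece R M n) = (hilbertSeries R M).coeff n := by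
  let := Ideal.Quotient.field (maximalIdeal R)
  have : Module.Finite (R ⧸ maximalIdeal R) (gradedPiece R M n) :=
    .of_restrictScalars_finite R _ _
  rw [hilbertSeries, PowerSeries.coeff_mk,
    Module.length_eq_of_surjective (R := R ⧸ maximalIdeal R) Ideal.Quotient.mk_surjective]
  exact Module.length_eq_finrank (R ⧸ maximalIdeal R) (gradedPiece R M n)

theorem length_pow_smul_top (M : Type u) [AddCommGroup M] [Module R M] [Module.Finite R M] (n : ℕ) :
    Module.length R (maximalIdeal R ^ n • ⊤ : Submodule R M) =
      Module.length R (maximalIdeal R ^ (n + 1) • ⊤ : Submodule R M) +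
        (hilbertSeries R M).coeff n := by
  rw [length_add_smul_top R (maximalIdeal R), length_gradedPiece]
  congr 1
  have h : (maximalIdeal R • (⊤ : Submodule R (maximalIdeal R ^ n • ⊤ : Submodule R M))).map
      (Submodule.subtype _) = maximalIdeal R ^ (n + 1) • ⊤ := by
    rw [Submodule.map_smul'', Submodule.map_top, Submodule.range_subtype, pow_succ',
      Submodule.mul_smul]
  rw [← h]
  exact (Submodule.equivMapOfInjective _ (Submodule.subtype_injective _) _).length_eq

theorem pow_smul_top_eq_bot (M : Type u) [AddCommGroup M] [Module R M] [Module.Finite R M] {n : ℕ}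
    (h : (hilbertSeries R M).coeff n = 0) : maximalIdeal R ^ n • (⊤ : Submodule R M) = ⊥ := by
  have h1 := length_gradedPiece (R := R) M n
  rw [h, Nat.cast_zero, Module.length_eq_zero_iff, Submodule.Quotient.subsingleton_iff] at h1
  have h2 : maximalIdeal R • (maximalIdeal R ^ n • ⊤ : Submodule R M) =
      maximalIdeal R ^ n • ⊤ := by
    have := congr_arg (Submodule.map (Submodule.subtype _)) h1
    rwa [Submodule.map_smul'', Submodule.map_top, Submodule.range_subtype] at this
  exact Submodule.eq_bot_of_le_smul_of_le_jacobson_bot _ _ (IsNoetherian.noetherian _) h2.ge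
    (maximalIdeal_le_jacobson _)

theorem maximalIdeal_cube_eq_bot_and_length {e s : ℕ}
    (hR : hilbertSeries R R =
      1 + PowerSeries.C e * PowerSeries.X + PowerSeries.C s * PowerSeries.X ^ 2) :
    maximalIdeal R ^ 3 = ⊥ ∧ Module.length R R = (1 + e + s : ℕ) ∧
      Module.length R (R ⧸ maximalIdeal R ^ 2) = (1 + e : ℕ) := by
  have c0 : (hilbertSeries R R).coeff 0 = 1 := by rw [hR]; simp
  have c1 : (hilbertSeries R R).coeff 1 = e := by
    rw [hR, map_add, map_add, PowerSeries.coeff_C_mul, PowerSeries.coeff_C_mul,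
      PowerSeries.coeff_one, PowerSeries.coeff_X, PowerSeries.coeff_X_pow]; simp
  have c2 : (hilbertSeries R R).coeff 2 = s := by
    rw [hR, map_add, map_add, PowerSeries.coeff_C_mul, PowerSeries.coeff_C_mul,
      PowerSeries.coeff_one, PowerSeries.coeff_X, PowerSeries.coeff_X_pow]; simp
  have c3 : (hilbertSeries R R).coeff 3 = 0 := by
    rw [hR, map_add, map_add, PowerSeries.coeff_C_mul, PowerSeries.coeff_C_mul,
      PowerSeries.coeff_one, PowerSeries.coeff_X, PowerSeries.coeff_X_pow]; simp
  have h3 : maximalIdeal R ^ 3 • (⊤ : Submodule R R) = ⊥ := pow_smul_top_eq_bot R c3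
  have l0 := length_pow_smul_top (R := R) R 0
  have l1 := length_pow_smul_top (R := R) R 1
  have l2 := length_pow_smul_top (R := R) R 2
  rw [c0, pow_zero, Ideal.one_eq_top, Submodule.top_smul, Module.length_top] at l0
  rw [c1] at l1
  rw [c2, h3, Module.length_bot, zero_add] at l2
  rw [l2] at l1
  rw [zero_add, l1] at l0
  have l := length_add_smul_top R (maximalIdeal R ^ 2) R
  rw [l2, smul_eq_mul, Ideal.mul_top, l0] at l
  refine ⟨by rwa [smul_eq_mul, Ideal.mul_top] at h3, ?_, ?_⟩
  · rw [l0]; push_cast; ring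
  · obtain ⟨t, ht⟩ := ENat.ne_top_iff_exists.1
      (show Module.length R (R ⧸ maximalIdeal R ^ 2) ≠ ⊤ by rintro h; rw [h] at l; simp at l)
    rw [← ht] at l ⊢
    norm_cast at l ⊢
    omega

end HilbertSeries

/-! ### Minimal resolutions and the relations between Betti numbers. -/

section Resolution

variable {R : Type u} [CommRing R]

theorem FiniteProjDim.of_shortExact {K Y : ModuleCat.{u} R} {P : Type u} [AddCommGroup P]
    [Module R P] [Module.Projective R P] {f : K →ₗ[R] P} {g : P →ₗ[R] Y}
    (h : IsFlatPresentation f g) (hK : FiniteProjDim K) : FiniteProjDim Y := by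
  obtain ⟨n, hn⟩ := (projectiveDimension_ne_top_iff K).1 hK
  rw [FiniteProjDim, projectiveDimension_ne_top_iff]
  let S : ShortComplex (ModuleCat.{u} R) := ⟨ModuleCat.ofHom f, ModuleCat.ofHom g, by
    ext x; exact h.exact.apply_apply_eq_zero x⟩
  have hS : S.ShortExact :=
    { exact := (ShortComplex.ShortExact.moduleCat_exact_iff_function_exact S).2 h.exact
      mono_f := (ModuleCat.mono_iff_injective _).2 h.injective
      epi_g := (ModuleCat.epi_iff_surjective _).2 h.surjective }
  have hP : Projective S.X₂ := (IsProjective.iff_projective _).1 ‹_›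
  exact ⟨n + 1, (hS.hasProjectiveDimensionLT_X₃_iff n hP).2 hn⟩

theorem FiniteProjDim.of_subsingleton (M : ModuleCat.{u} R) [Subsingleton M] : FiniteProjDim M := by
  rw [FiniteProjDim, (projectiveDimension_eq_bot_iff M).2 (ModuleCat.isZero_of_subsingleton M)]
  exact bot_ne_top

variable [IsLocalRing R]

/-- `A` is the sequence of syzygies, and `n` the sequence of ranks, in a minimal free resolution. -/
def IsMinimalResolution (A : ℕ → ModuleCat.{u} R) (n : ℕ → ℕ) : Prop :=
  ∀ i, ∃ (f : A (i + 1) →ₗ[R] (Fin (n i) → R)) (g : (Fin (n i) → R) →ₗ[R] A i),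
    IsMinimalPresentation f g

theorem exists_isMinimalResolution [IsNoetherianRing R] (M : ModuleCat.{u} R) [Module.Finite R M]
    (hM : ¬ FiniteProjDim M) :
    ∃ A n, A 0 = M ∧ IsMinimalResolution A n ∧ ∀ i, Module.Finite R (A i) ∧ Nontrivial (A i) := by
  -- Infinite projective dimension passes to syzygies; carrying it through the iteration keeps every
  -- syzygy nonzero.
  let T := {M : ModuleCat.{u} R // Module.Finite R M ∧ ¬ FiniteProjDim M}
  have step (M : T) : ∃ (K : T) (n : ℕ) (f : K.1 →ₗ[R] (Fin n → R)) (g : (Fin n → R) →ₗ[R] M.1),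
      IsMinimalPresentation f g := by
    obtain ⟨M, hfin, hM⟩ := M
    obtain ⟨n, g, hg, hk⟩ := exists_minimal_cover (R := R) M
    have h : IsMinimalPresentation (LinearMap.ker g).subtype g :=
      ⟨.of_surjective hg, by rwa [Submodule.range_subtype]⟩
    have hK : ¬ FiniteProjDim (ModuleCat.of R (LinearMap.ker g)) := fun hK =>
      hM (.of_shortExact (K := ModuleCat.of R (LinearMap.ker g)) h.toIsFlatPresentation hK)
    have hKfin : Module.Finite R (LinearMap.ker g) := inferInstance
    exact ⟨⟨ModuleCat.of R (LinearMap.ker g), hKfin, hK⟩, n, _, g, h⟩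
  choose Ω n hΩ using step
  let B (i : ℕ) : T := Ω^[i] ⟨M, ‹_›, hM⟩
  refine ⟨fun i => (B i).1, fun i => n (B i), rfl, fun i => ?_, fun i => ⟨(B i).2.1, ?_⟩⟩
  · have h (K : T) (hK : K = Ω (B i)) : ∃ (f : K.1 →ₗ[R] (Fin (n (B i)) → R))
        (g : (Fin (n (B i)) → R) →ₗ[R] (B i).1), IsMinimalPresentation f g := hK ▸ hΩ (B i)
    exact h _ (Function.iterate_succ_apply' _ _ _)
  · by_contra h
    rw [not_nontrivial_iff_subsingleton] at h
    exact (B i).2.2 (.of_subsingleton _)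

theorem IsMinimalResolution.isSyzygy {A : ℕ → ModuleCat.{u} R} {n : ℕ → ℕ}
    (h : IsMinimalResolution A n) (i : ℕ) : IsSyzygy (A (i + 1)) (A i) := by
  obtain ⟨f, g, hfg⟩ := h i
  exact ⟨ModuleCat.of R (Fin (n i) → R), f, g, hfg.toIsFlatPresentation⟩

theorem IsMinimalResolution.pos {A : ℕ → ModuleCat.{u} R} {n : ℕ → ℕ}
    (h : IsMinimalResolution A n) (i : ℕ) [Nontrivial (A i)] : 0 < n i := by
  obtain ⟨f, g, hfg⟩ := h i
  rw [Nat.pos_iff_ne_zero]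
  intro h0
  have : IsEmpty (Fin (n i)) := h0 ▸ inferInstance
  exact not_subsingleton (A i) hfg.surjective.subsingleton

theorem IsMinimalResolution.relations [IsNoetherianRing R] {e s : ℕ}
    (hR : hilbertSeries R R =
      1 + PowerSeries.C e * PowerSeries.X + PowerSeries.C s * PowerSeries.X ^ 2)
    {A B : ℕ → ModuleCat.{u} R} {a b : ℕ → ℕ} (hA : IsMinimalResolution A a)
    (hB : IsMinimalResolution B b) (hA' : ∀ i, Nontrivial (A i))
    (hB' : ∀ i, Module.Finite R (B i)) (i : ℕ)
    (hT : ∀ p q, i ≤ p → i ≤ q → TorOneVanishes R (A p) (B q)) :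
    a (i + 1) * b (i + 2) + a (i + 2) * b (i + 1) = e * (a (i + 1) * b (i + 1)) ∧
      a (i + 2) * b (i + 2) = s * (a (i + 1) * b (i + 1)) := by
  obtain ⟨h3, hlen, hlen2⟩ := maximalIdeal_cube_eq_bot_and_length hR
  obtain ⟨f₀, g₀, h₀⟩ := hA i
  obtain ⟨f₁, g₁, h₁⟩ := hA (i + 1)
  obtain ⟨f₂, g₂, h₂⟩ := hA (i + 2)
  obtain ⟨f₀', g₀', h₀'⟩ := hB i
  obtain ⟨f₁', g₁', h₁'⟩ := hB (i + 1)
  obtain ⟨f₂', g₂', h₂'⟩ := hB (i + 2)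
  have hB1 := h₀'.sq_smul_top_eq_bot h3
  have hB2 := h₁'.sq_smul_top_eq_bot h3
  have := hB' (i + 1)
  have := hB' (i + 2)
  have := hA' (i + 2)
  have e1 := length_count h₀ h₁ hB1 (hT _ _ (by omega) (by omega)) (hT _ _ (by omega) (by omega))
  have e2 := length_count h₀ h₁ hB2 (hT _ _ (by omega) (by omega)) (hT _ _ (by omega) (by omega))
  have e3 := length_add_smul_top R (maximalIdeal R) (B (i + 2))
  have e4 := Module.length_eq_add_of_exact f₁' g₁' h₁'.injective h₁'.surjective h₁'.exact
  have e5 := length_add_smul_top R (maximalIdeal R ^ 2) (Fin (b (i + 1)) → R)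
  have e6 := (Submodule.equivMapOfInjective f₁' h₁'.injective
    (maximalIdeal R • (⊤ : Submodule R (B (i + 2))))).length_eq
  rw [smul_eq_sq_smul h₁ h₁' h3 hB1 (hT _ _ (by omega) (by omega))] at e6
  rw [← betti] at e3
  rw [length_pi_quotient, ← e6, hlen2] at e5
  rw [h₂.betti_eq, h₁'.betti_eq] at e1
  rw [h₂.betti_eq, h₂'.betti_eq] at e2
  rw [h₂'.betti_eq] at e3
  have hpi : Module.length R (Fin (b (i + 1)) → R) = (b (i + 1) * (1 + e + s) : ℕ) := by
    rw [Module.length_pi_of_fintype]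
    simp [hlen, mul_add]
  rw [hpi] at e4 e5
  generalize Module.length R (B (i + 1)) = L₁ at *
  generalize Module.length R (B (i + 2)) = L₂ at *
  generalize Module.length R
    (maximalIdeal R • (⊤ : Submodule R (B (i + 2))) : Submodule R (B (i + 2))) = μ at *
  have fin (x y : ℕ∞) (n : ℕ) (h : (n : ℕ∞) = x + y) : (∃ p : ℕ, x = p) ∧ ∃ q : ℕ, y = q := by
    have hx : x ≠ ⊤ := by rintro rfl; simp at h
    have hy : y ≠ ⊤ := by rintro rfl; simp at h
    exact ⟨⟨_, (ENat.natCast_toNat hx).symm⟩, ⟨_, (ENat.natCast_toNat hy).symm⟩⟩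
  obtain ⟨⟨L₂, rfl⟩, ⟨L₁, rfl⟩⟩ := fin _ _ _ e4
  obtain ⟨⟨μ, rfl⟩, -⟩ := fin _ _ _ e5
  norm_cast at e1 e2 e3 e4 e5
  -- Here `μ` is the length of 𝔪B(i+2) = 𝔪²F, with F free of rank `b (i + 1)`.
  have hμ : μ = b (i + 1) * s := by linarith
  subst hμ e3
  constructor
  · have : L₁ + b (i + 2) = b (i + 1) * (1 + e) := by linarith
    have := congr_arg (a (i + 1) * ·) this
    linarith
  · linarith

theorem TorBounded.relations [IsNoetherianRing R] {e s : ℕ}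
    (hR : hilbertSeries R R =
      1 + PowerSeries.C e * PowerSeries.X + PowerSeries.C s * PowerSeries.X ^ 2)
    {M N : ModuleCat.{u} R} (hT : TorBounded M N)
    {A B : ℕ → ModuleCat.{u} R} {a b : ℕ → ℕ} (hA : IsMinimalResolution A a)
    (hB : IsMinimalResolution B b) (hA0 : A 0 = M) (hB0 : B 0 = N) (hA' : ∀ i, Nontrivial (A i))
    (hB' : ∀ i, Module.Finite R (B i)) :
    ∃ i, a (i + 1) * b (i + 2) + a (i + 2) * b (i + 1) = e * (a (i + 1) * b (i + 1)) ∧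
      a (i + 2) * b (i + 2) = s * (a (i + 1) * b (i + 1)) := by
  obtain ⟨C, hC0, hC, i, hi⟩ := hT.exists_torOneVanishes
  refine ⟨i, hA.relations hR hB hA' hB' i fun p q hp hq => ?_⟩
  -- All shifts are moved onto `A`, the resolution `B` of `N` is exchanged for `C`, and the shifts
  -- are moved back onto `C`.
  rw [← torOneVanishes_add_iff hA.isSyzygy hB.isSyzygy, hB0, ← hC0, ← zero_add (p + q),
    torOneVanishes_add_iff hA.isSyzygy hC, hA0]
  exact hi _ (by omega)

end Resolution

/-! ### Arithmetic of the ratios, and the theorem. -/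

theorem exists_add_mul_of_relations {x₁ x₂ y₁ y₂ e s : ℕ} (hx₁ : 0 < x₁) (hx₂ : 0 < x₂)
    (hy₁ : 0 < y₁) (hy₂ : 0 < y₂) (h : x₁ * y₂ + x₂ * y₁ = e * (x₁ * y₁))
    (h' : x₂ * y₂ = s * (x₁ * y₁)) :
    ∃ u v : ℕ, 0 < u ∧ 0 < v ∧ u + v = e ∧ u * v = s ∧ x₂ = u * x₁ ∧ y₂ = v * y₁ := by
  have key (h1 : (x₂ : ℤ) * (e * x₁ - x₂) = s * x₁ ^ 2) : x₁ ∣ x₂ := by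
    -- Completing the square: `x₁²` divides a square, so the discriminant is a square `k²`, and `k`
    -- has the parity of `e`.
    have h2 : (2 * x₂ - e * x₁ : ℤ) ^ 2 = (e ^ 2 - 4 * s) * x₁ ^ 2 := by linarith
    obtain ⟨k, hk⟩ : (x₁ : ℤ) ∣ 2 * x₂ - e * x₁ :=
      (Int.pow_dvd_pow_iff two_ne_zero).1 ⟨_, h2.trans (mul_comm _ _)⟩
    have h3 : k ^ 2 = e ^ 2 - 4 * s := by
      have : (x₁ : ℤ) ^ 2 ≠ 0 := by positivity
      apply mul_right_cancel₀ this
      rw [← h2, hk]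
      ring
    have h4 : Even (k + e) := by
      have : Even ((k + e) ^ 2) := ⟨k * e + e ^ 2 - 2 * s, by linear_combination h3⟩
      exact (Int.even_pow' two_ne_zero).1 this
    obtain ⟨u, hu⟩ := h4
    exact Int.natCast_dvd_natCast.1
      ⟨u, mul_left_cancel₀ two_ne_zero (by linear_combination hk + x₁ * hu)⟩
  have h1 : (x₂ : ℤ) * (e * x₁ - x₂) = s * x₁ ^ 2 := by
    zify at h h'
    have : (y₁ : ℤ) ≠ 0 := by positivity
    apply mul_left_cancel₀ this
    linear_combination (-x₂) * h + x₁ * h'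
  obtain ⟨u, rfl⟩ := key h1
  have hu : 0 < u := Nat.pos_of_mul_pos_left hx₂
  have h2 : y₂ + u * y₁ = e * y₁ := Nat.eq_of_mul_eq_mul_left hx₁ (by linarith)
  have h3 : u * y₂ = s * y₁ := Nat.eq_of_mul_eq_mul_left hx₁ (by linarith)
  have hlt : u < e := lt_of_mul_lt_mul_right (by omega : u * y₁ < e * y₁) hy₁.le
  obtain ⟨v, rfl⟩ := Nat.exists_eq_add_of_lt hlt
  have h4 : y₂ = (v + 1) * y₁ := by linarith
  refine ⟨u, v + 1, hu, v.succ_pos, rfl, ?_, mul_comm _ _, h4⟩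
  rw [h4, ← mul_assoc] at h3
  exact Nat.eq_of_mul_eq_mul_right hy₁ h3

theorem theorem3p6 (R : Type u) [CommRing R] [IsLocalRing R] [IsNoetherianRing R]
    (e s : ℕ)
    (hR : hilbertSeries R R =
      1 + PowerSeries.C e * PowerSeries.X + PowerSeries.C s * PowerSeries.X ^ 2) :
    ((s = 0 ∨ ¬ IsSquare ((e : ℤ) ^ 2 - 4 * (s : ℤ))) → TorFriendly R) ∧
    ((s = 0 ∨ (e : ℤ) ^ 2 - 4 * (s : ℤ) ≠ 0) → TorPersistent R) ∧
    (∀ M N : ModuleCat.{u} R, Module.Finite R M → Module.Finite R N →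
      ¬ FiniteProjDim M → ¬ FiniteProjDim N → TorBounded M N →
      ∃ u v : ℕ, 0 < u ∧ 0 < v ∧
        hilbertSeries R R =
          (1 + PowerSeries.C u * PowerSeries.X) * (1 + PowerSeries.C v * PowerSeries.X)) := by
  have key (M N : ModuleCat.{u} R) (_ : Module.Finite R M) (_ : Module.Finite R N)
      (hM : ¬ FiniteProjDim M) (hN : ¬ FiniteProjDim N) (hT : TorBounded M N) :
      ∃ u v : ℕ, 0 < u ∧ 0 < v ∧ u + v = e ∧ u * v = s := by
    obtain ⟨A, a, hA0, hA, hA'⟩ := exists_isMinimalResolution M hM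
    obtain ⟨B, b, hB0, hB, hB'⟩ := exists_isMinimalResolution N hN
    have := fun i => (hA' i).2
    have := fun i => (hB' i).2
    obtain ⟨i, h1, h2⟩ := hT.relations hR hA hB hA0 hB0 (fun i => (hA' i).2) fun i => (hB' i).1
    obtain ⟨u, v, hu, hv, huv, huv', -, -⟩ := exists_add_mul_of_relations
      (hA.pos _) (hA.pos _) (hB.pos _) (hB.pos _) h1 h2
    exact ⟨u, v, hu, hv, huv, huv'⟩
  refine ⟨fun h M N hM hN hT => ?_, fun h M hM hT => ?_, fun M N hM hN hM' hN' hT => ?_⟩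
  · by_contra! H
    obtain ⟨u, v, hu, hv, rfl, rfl⟩ := key M N hM hN H.1 H.2 hT
    obtain h | h := h
    · exact (Nat.mul_pos hu hv).ne' h
    · exact h ⟨u - v, by push_cast; ring⟩
  · by_contra H
    obtain ⟨A, a, hA0, hA, hA'⟩ := exists_isMinimalResolution M H
    have := fun i => (hA' i).2
    -- One resolution serves both factors, so `u` and `v` are the same ratio.
    obtain ⟨i, h1, h2⟩ := hT.relations hR hA hA hA0 hA0 (fun i => (hA' i).2) fun i => (hA' i).1
    obtain ⟨u, v, hu, hv, rfl, rfl, h3, h4⟩ := exists_add_mul_of_relations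
      (hA.pos _) (hA.pos _) (hA.pos _) (hA.pos _) h1 h2
    have huv : u = v := Nat.eq_of_mul_eq_mul_right (hA.pos _) (h3.symm.trans h4)
    subst huv
    obtain h | h := h
    · exact (Nat.mul_pos hu hv).ne' h
    · exact h (by push_cast; ring)
  · obtain ⟨u, v, hu, hv, rfl, rfl⟩ := key M N hM hN hM' hN' hT
    refine ⟨u, v, hu, hv, ?_⟩
    rw [hR, map_add, map_mul]
    ring
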